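/- Online maximum matching with edge $k$-bounded recourse, limited departure model. A request sequence starts from the empty graph; each request either inserts an edge that has not been inserted before (between two arbitrary distinct vertices, new or old) or deletes an edge of the current graph that is not currently accepted by the algorithm. After each request a deterministic online algorithm, knowing only the requests so far, must hold a set of accepted edges that is a matching of the current graph. Every edge is initially rejected, and the algorithm may change its decision on each edge (from rejected to accepted or from accepted to rejected) at most $k$ times in total. For an admissible request sequence $\sigma$, let $\mathrm{ALG}(\sigma)$ be the number of edges accepted by the algorithm after $\sigma$, and let $\mathrm{OPT}(\sigma)$ be the maximum cardinality of a matching of the graph present after $\sigma$. The algorithm is $c$-competitive, for a real $c>0$, if $\mathrm{ALG}(\sigma)\ge \mathrm{OPT}(\sigma)/c$ for all admissible $\sigma$ (no additive constant), and its competitive ratio is the infimum of all such $c$ ($+\infty$ if there are none). Theorem. For every even integer $k\ge 4$, every deterministic online algorithm for this problem has competitive ratio at least $$\frac{k^2-3k+6}{k^2-4k+7}.$$ -/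

import Mathlib

namespace RecourseMatching

/-- An edge is an unordered pair of vertices; vertices are named by natural numbers. -/
abbrev Edge := Sym2 ℕ

/-- A request of the edge arrival/departure model. -/
inductive Request where
  | arrive (e : Edge) : Request
  | depart (e : Edge) : Request

/-- A finite request sequence, with the most recent request at the head of the list. -/
abbrev History := List Request

/-- The edge set of the current graph. -/
def present : History → Finset Edge
  | [] => ∅
  | Request.arrive e :: σ => insert e (present σ)
  | Request.depart e :: σ => (present σ).erase e

/-- A set of edges with pairwise disjoint endpoints. -/
def IsMatching (M : Finset Edge) : Prop :=
  ∀ e ∈ M, ∀ f ∈ M, ∀ v : ℕ, v ∈ e → v ∈ f → e = f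

open scoped Classical in
/-- The maximum cardinality of a matching contained in the edge set `E`. -/
noncomputable def opt (E : Finset Edge) : ℕ :=
  (E.powerset.filter IsMatching).sup Finset.card

/-- A deterministic online algorithm: the set of edges it currently accepts is a function of the
requests received so far. After every request (arrival or departure) it may change its mind about
any edges. -/
abbrev OnlineAlgorithm := History → Finset Edge

/-- The request sequences that the adversary may issue against the algorithm `A` in the limited
departure model. An arriving edge is not a loop and has not arrived before; a departing edge
belongs to the current graph and is not currently accepted by `A`. -/
def Admissible (A : OnlineAlgorithm) : History → Prop
  | [] => True
  | Request.arrive e :: σ => Admissible A σ ∧ ¬ e.IsDiag ∧ Request.arrive e ∉ σ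
  | Request.depart e :: σ => Admissible A σ ∧ e ∈ present σ ∧ e ∉ A σ

/-- The type of the edge `e`: the number of times that `A` has changed its decision on `e`
(accepting it or rejecting it after having accepted it). Every edge is initially rejected. -/
def edgeType (A : OnlineAlgorithm) (e : Edge) : History → ℕ
  | [] => 0
  | r :: σ => edgeType A e σ + if (e ∈ A (r :: σ) ↔ e ∈ A σ) then 0 else 1

/-- `A` solves online matching with edge `k`-bounded recourse in the limited departure model: at
all times it maintains a matching of the current graph, and no edge has undergone more than `k`
decision changes. -/
def SolvesWithRecourse (k : ℕ) (A : OnlineAlgorithm) : Prop :=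
  ∀ σ : History, Admissible A σ →
    A σ ⊆ present σ ∧ IsMatching (A σ) ∧ ∀ e : Edge, edgeType A e σ ≤ k

/-- `A` is (strictly) `c`-competitive: `ALG(σ) ≥ OPT(σ) / c` for all request sequences `σ`, where
`OPT(σ)` is the size of a maximum matching of the current graph. -/
def IsCompetitive (A : OnlineAlgorithm) (c : ℝ) : Prop :=
  0 < c ∧ ∀ σ : History, Admissible A σ → (opt (present σ) : ℝ) / c ≤ ((A σ).card : ℝ)

/-- The (strict) competitive ratio: the infimum of all `c` for which `A` is `c`-competitive; it is
`⊤` if there are none. -/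
noncomputable def competitiveRatio (A : OnlineAlgorithm) : EReal :=
  ⨅ (c : ℝ) (_ : IsCompetitive A c), (c : EReal)

end RecourseMatching

/-!
The adversary keeps the current graph a disjoint union of paths with evenly many vertices and
works with the types of their edges. If a path is not perfectly matched, its maximum matching
exceeds the number of its accepted edges by at least one. If it is perfectly matched, its edges
are accepted and rejected alternately, and every type has the parity that belongs to the decision
on its edge. Two moves are then available. The path may be extended by a new edge at each end:
perfectly matching the longer path changes the decision on every old edge and so raises all types
by one. Or a rejected edge may be deleted, which splits the path into two perfectly matched paths.
Since no type exceeds `k`, a path that has been extended often enough can no longer be perfectly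
matched.

Let `R = 1 + ρ` be the claimed ratio. The adversary aims at a large value of `OPT - R * ALG`, to
which a path contributes `1` for every edge that is missing from its perfect matching and `-ρ` for
every accepted edge. A plan for a path (`Worth`) says what to do whenever the path is perfectly
matched; its value is a lower bound for what the path will contribute in the end, and a plan for a
path is assembled from plans for the paths it is turned into. If a new single edge has a plan of
positive value, then many single edges give a contradiction to any ratio below `R`
(`not_isCompetitive`), even if a bounded amount of value is lost.

For `k ≥ 6` (`exists_worth_pos`) the plans concern the paths with types `1, …, k - 1`, paths with
types `1, …, k - 3`, and single edges. A path `1, …, k - 1` is extended once to `1, …, k`, `1`,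
and its end `k - 1, k, 1`, whose middle edge has used up its recourse, is cut off; what remains is
a path `1, …, k - 3`. That one is extended twice to `1, …, k - 1, 2, 1` and yields a path
`1, …, k - 1` and a single edge. A single edge is extended to `1, …, k - 3, k - 2, k - 3, …, 1` and yields
two paths `1, …, k - 3`. Each of the three plans uses the others, and starting from the plan to do
nothing, finitely many rounds of improvement lead to a positive value.

For `k = 4` this improvement does not get started from nothing. Therefore single edges are first
collected in banks (`not_isCompetitive_four`): as soon as sufficiently many edges wait at a bank,
they are linked to a path on which the adversary can play (`State.withdraw`). A bank credits every
edge with its share of the value of that path, and because only boundedly many edges ever remain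
at the banks, the credit is lost for a bounded number of edges only.
-/

namespace RecourseMatching

/-! ### Paths and matchings -/

/-- The edges of the path that visits the vertices of a list in their order. -/
def pathEdges : List ℕ → List Edge
  | u :: v :: p => s(u, v) :: pathEdges (v :: p)
  | _ => []

/-- The edges at the even positions of a path, its first edge being at position `0`. -/
def pairs : List ℕ → List Edge
  | u :: v :: p => s(u, v) :: pairs p
  | _ => []

theorem pathEdges_append (p q : List ℕ) (a b : ℕ) :
    pathEdges (p ++ [a] ++ b :: q) = pathEdges (p ++ [a]) ++ s(a, b) :: pathEdges (b :: q) := by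
  induction p with
  | nil => simp [pathEdges]
  | cons x p ih =>
    cases p with
    | nil => simp [pathEdges]
    | cons y p => simpa [pathEdges] using ih

theorem length_pathEdges_cons (a : ℕ) (p : List ℕ) : (pathEdges (a :: p)).length = p.length := by
  induction p generalizing a with
  | nil => rfl
  | cons b p ih => simp [pathEdges, ih]

theorem length_pathEdges {p : List ℕ} (hp : p ≠ []) :
    (pathEdges p).length + 1 = p.length := by
  cases p with
  | nil => exact absurd rfl hp
  | cons a p => simp [length_pathEdges_cons]

theorem pathEdges_reverse (p : List ℕ) : pathEdges p.reverse = (pathEdges p).reverse := by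
  induction p with
  | nil => rfl
  | cons a p ih =>
    cases p with
    | nil => rfl
    | cons b p =>
      have h := pathEdges_append p.reverse [] b a
      simp only [List.reverse_cons, pathEdges] at h ih ⊢
      rw [h, ih, Sym2.eq_swap]

theorem mem_of_mem_pathEdges {p : List ℕ} {e : Edge} {v : ℕ} (he : e ∈ pathEdges p)
    (hv : v ∈ e) : v ∈ p := by
  induction p with
  | nil => simp [pathEdges] at he
  | cons a p ih =>
    cases p with
    | nil => simp [pathEdges] at he
    | cons b p =>
      simp only [pathEdges, List.mem_cons] at he
      rcases he with rfl | he
      · rcases Sym2.mem_iff.1 hv with rfl | rfl <;> simp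
      · exact List.mem_cons_of_mem _ (ih he)

theorem mem_of_mem_pairs : ∀ {p : List ℕ} {e : Edge} {v : ℕ}, e ∈ pairs p → v ∈ e → v ∈ p
  | u :: v :: p, e, x, he, hx => by
    simp only [pairs, List.mem_cons] at he
    rcases he with rfl | he
    · rcases Sym2.mem_iff.1 hx with rfl | rfl <;> simp
    · have := mem_of_mem_pairs he hx
      simp [this]
  | [], _, _, he, _ => by simp [pairs] at he
  | [_], _, _, he, _ => by simp [pairs] at he

theorem pairs_subset_pathEdges : ∀ p : List ℕ, pairs p ⊆ pathEdges p
  | u :: v :: p => by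
    intro e he
    simp only [pairs, List.mem_cons] at he
    rcases he with rfl | he
    · simp [pathEdges]
    · have h := pairs_subset_pathEdges p he
      cases p with
      | nil => simp [pathEdges] at h
      | cons w p => simp [pathEdges, h]
  | [] => by simp [pairs]
  | [_] => by simp [pairs]

theorem pairs_append : ∀ (p q : List ℕ), Even p.length → pairs (p ++ q) = pairs p ++ pairs q
  | u :: v :: p, q, h => by
    have : Even p.length := by
      simp only [List.length_cons] at h
      grind
    simp [pairs, pairs_append p q this]
  | [], q, _ => by simp [pairs]
  | [_], q, h => by simp at h

theorem length_pairs : ∀ p : List ℕ, (pairs p).length = p.length / 2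
  | u :: v :: p => by
    simp only [pairs, List.length_cons, length_pairs p]
    omega
  | [] => by simp [pairs]
  | [_] => by simp [pairs]

theorem nodup_pairs : ∀ {p : List ℕ}, p.Nodup → (pairs p).Nodup
  | u :: v :: p, h => by
    simp only [List.nodup_cons, List.mem_cons, not_or] at h
    simp only [pairs, List.nodup_cons]
    exact ⟨fun he => h.1.2 (mem_of_mem_pairs he (Sym2.mem_mk_left u v)), nodup_pairs h.2.2⟩
  | [], _ => by simp [pairs]
  | [_], _ => by simp [pairs]

theorem isMatching_pairs : ∀ {p : List ℕ}, p.Nodup → IsMatching (pairs p).toFinset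
  | u :: v :: p, h => by
    simp only [List.nodup_cons, List.mem_cons, not_or] at h
    have key : ∀ f ∈ pairs p, ∀ x, x ∈ s(u, v) → x ∉ f := by
      intro f hf x hx hxf
      have := mem_of_mem_pairs hf hxf
      rcases Sym2.mem_iff.1 hx with rfl | rfl
      · exact h.1.2 this
      · exact h.2.1 this
    intro e he f hf x hxe hxf
    simp only [pairs, List.toFinset_cons, Finset.mem_insert, List.mem_toFinset] at he hf
    rcases he with rfl | he <;> rcases hf with rfl | hf
    · rfl
    · exact absurd hxf (key f hf x hxe)
    · exact absurd hxe (key e he x hxf)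
    · exact isMatching_pairs h.2.2 e (by simpa using he) f (by simpa using hf) x hxe hxf
  | [], _ => by simp [pairs, IsMatching]
  | [_], _ => by simp [pairs, IsMatching]

theorem card_le_opt {M E : Finset Edge} (hM : IsMatching M) (hME : M ⊆ E) : M.card ≤ opt E := by
  classical
  unfold opt
  refine Finset.le_sup (f := Finset.card) ?_
  simp [hM, hME]

/-! ### Edge types -/

theorem edgeType_le_cons (A : OnlineAlgorithm) (e : Edge) (r : Request) (σ : History) :
    edgeType A e σ ≤ edgeType A e (r :: σ) := Nat.le_add_right _ _

theorem odd_edgeType_iff {A : OnlineAlgorithm} {e : Edge} (h : e ∉ A []) (σ : History) :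
    Odd (edgeType A e σ) ↔ e ∈ A σ := by
  induction σ with
  | nil => simp [edgeType, h]
  | cons r σ ih =>
    by_cases hr : e ∈ A (r :: σ) ↔ e ∈ A σ
    · simp [edgeType, hr, ih]
    · simp only [edgeType, hr, if_false, Nat.odd_add_one, ih]
      tauto

/-! ### Decompositions of the current graph into paths -/

/-- A path component of the current graph, with lower bounds on the types of its edges. A set flag
`left` or `right` records that the end of the path on that side has never been joined to a vertex
other than its neighbour on the path. -/
structure Block where
  verts : List ℕ
  bounds : List ℕ
  left : Bool
  right : Bool

/-- The path `p` is present in the current graph and its edges have at least the types `b`. -/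
def Carries (A : OnlineAlgorithm) (σ : History) (p b : List ℕ) : Prop :=
  p ≠ [] ∧ List.Forall₂ (fun e x => e ∈ present σ ∧ x ≤ edgeType A e σ) (pathEdges p) b

/-- All edges that ever arrived at the last vertex of `p` belong to the path `p`. -/
def LastPendant (σ : History) (p : List ℕ) : Prop :=
  ∀ q y, p = q ++ [y] → ∀ e, Request.arrive e ∈ σ → y ∈ e → e ∈ pathEdges p

/-- What a block asserts about the graph after `σ`. -/
structure Block.Holds (A : OnlineAlgorithm) (σ : History) (B : Block) : Prop where
  carries : Carries A σ B.verts B.bounds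
  left : B.left = true → LastPendant σ B.verts.reverse
  right : B.right = true → LastPendant σ B.verts

/-- The blocks of `l` are vertex-disjoint paths that make up the whole current graph. -/
structure Layout (A : OnlineAlgorithm) (σ : History) (l : List Block) : Prop where
  admissible : Admissible A σ
  nodup : (l.flatMap Block.verts).Nodup
  cover : ∀ e ∈ present σ, ∃ B ∈ l, e ∈ pathEdges B.verts
  holds : ∀ B ∈ l, B.Holds A σ

theorem Layout.perm {A : OnlineAlgorithm} {σ : History} {l l' : List Block} (h : Layout A σ l)
    (hl : l.Perm l') : Layout A σ l' :=
  ⟨h.admissible, (hl.flatMap_right _).nodup_iff.1 h.nodup,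
    fun e he => by
      obtain ⟨B, hB, h2⟩ := h.cover e he
      exact ⟨B, hl.mem_iff.1 hB, h2⟩,
    fun B hB => h.holds B (hl.mem_iff.2 hB)⟩

theorem Carries.mono {A : OnlineAlgorithm} {σ : History} {p b b' : List ℕ} (h : Carries A σ p b)
    (hb : List.Forall₂ (· ≤ ·) b' b) : Carries A σ p b' := by
  obtain ⟨hne, h2⟩ := h
  refine ⟨hne, ?_⟩
  generalize pathEdges p = l at h2 ⊢
  induction h2 generalizing b' with
  | nil => cases hb; exact .nil
  | cons h1 _ ih =>
    cases hb with
    | cons h3 h4 => exact .cons ⟨h1.1, h3.trans h1.2⟩ (ih h4)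

theorem Carries.of_imp {A : OnlineAlgorithm} {σ σ' : History} {p b : List ℕ}
    (h : Carries A σ p b) (hp : ∀ e ∈ pathEdges p, e ∈ present σ → e ∈ present σ')
    (ht : ∀ e, edgeType A e σ ≤ edgeType A e σ') : Carries A σ' p b := by
  obtain ⟨hne, h2⟩ := h
  refine ⟨hne, ?_⟩
  generalize pathEdges p = l at h2 hp ⊢
  induction h2 with
  | nil => exact .nil
  | cons h1 _ ih =>
    exact .cons ⟨hp _ (by simp) h1.1, h1.2.trans (ht _)⟩
      (ih fun e he => hp e (List.mem_cons_of_mem _ he))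

theorem Carries.reverse {A : OnlineAlgorithm} {σ : History} {p b : List ℕ}
    (h : Carries A σ p b) : Carries A σ p.reverse b.reverse := by
  refine ⟨by simpa using h.1, ?_⟩
  rw [pathEdges_reverse]
  exact List.rel_reverse h.2

theorem Carries.length {A : OnlineAlgorithm} {σ : History} {p b : List ℕ}
    (h : Carries A σ p b) : p.length = b.length + 1 := by
  rw [← h.2.length_eq, length_pathEdges h.1]

theorem Carries.mem_present {A : OnlineAlgorithm} {σ : History} {p b : List ℕ}
    (h : Carries A σ p b) {e : Edge} (he : e ∈ pathEdges p) : e ∈ present σ := by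
  obtain ⟨-, h2⟩ := h
  generalize pathEdges p = l at h2 he
  induction h2 with
  | nil => simp at he
  | cons h1 _ ih =>
    rcases List.mem_cons.1 he with rfl | he
    · exact h1.1
    · exact ih he

/-- Two blocks joined by an edge of type `0` between the end of the first and the beginning of the
second. -/
def Block.link (B C : Block) : Block :=
  ⟨B.verts ++ C.verts, B.bounds ++ 0 :: C.bounds, B.left, C.right⟩

/-- An isolated vertex. -/
def Block.vertex (u : ℕ) : Block := ⟨[u], [], true, true⟩

/-- A vertex that has never occurred in a request can be added to every layout. -/
theorem Layout.exists_vertex {A : OnlineAlgorithm} {σ : History} {l : List Block}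
    (h : Layout A σ l) : ∃ u, Layout A σ (Block.vertex u :: l) := by
  have hfin : ∀ τ : History, ∃ N : ℕ, ∀ e, Request.arrive e ∈ τ → ∀ v ∈ e, v < N := by
    intro τ
    induction τ with
    | nil => exact ⟨0, by simp⟩
    | cons r τ ih =>
      obtain ⟨N, hN⟩ := ih
      cases r with
      | arrive f =>
        induction f using Sym2.inductionOn with
        | hf x y =>
          refine ⟨N + x + y + 1, fun e he v hv => ?_⟩
          simp only [List.mem_cons, Request.arrive.injEq] at he
          rcases he with rfl | he
          · rcases Sym2.mem_iff.1 hv with rfl | rfl <;> omega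
          · have := hN e he v hv
            omega
      | depart f => exact ⟨N, fun e he => hN e (by simpa using he)⟩
  obtain ⟨N, hN⟩ := hfin σ
  obtain ⟨u, hu⟩ : ∃ u, u ∉ Finset.range N ∪ (l.flatMap Block.verts).toFinset :=
    Infinite.exists_notMem_finset _
  simp only [Finset.mem_union, Finset.mem_range, List.mem_toFinset, not_or] at hu
  have hpend : LastPendant σ [u] := by
    intro q y hq e he hy
    have : u = y := by
      cases q with
      | nil => simpa using hq
      | cons a q => simp at hq
    subst this
    exact absurd (hN e he u hy) hu.1
  refine ⟨u, h.admissible, ?_, ?_, ?_⟩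
  · simp only [List.flatMap_cons, Block.vertex, List.singleton_append, List.nodup_cons]
    exact ⟨hu.2, h.nodup⟩
  · intro e he
    obtain ⟨B, hB, h2⟩ := h.cover e he
    exact ⟨B, List.mem_cons_of_mem _ hB, h2⟩
  · intro B hB
    rcases List.mem_cons.1 hB with rfl | hB
    · exact ⟨⟨by simp [Block.vertex], .nil⟩, fun _ => hpend, fun _ => hpend⟩
    · exact h.holds B hB

theorem exists_concat {α : Type*} {l : List α} (h : l ≠ []) : ∃ q a, l = q ++ [a] :=
  ⟨l.dropLast, l.getLast h, (List.dropLast_append_getLast h).symm⟩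

/-- Two blocks can be linked as soon as one of the two ends to be joined is pendant, because then
the new edge has never arrived before. -/
theorem Layout.link {A : OnlineAlgorithm} {σ : History} {B C : Block} {l : List Block}
    (h : Layout A σ (B :: C :: l)) (hBC : B.right = true ∨ C.left = true) :
    ∃ τ, Layout A τ (B.link C :: l) := by
  have hB := h.holds B (by simp)
  have hC := h.holds C (by simp)
  obtain ⟨p, a, hp⟩ := exists_concat hB.carries.1
  obtain ⟨b, q, hq⟩ := List.exists_cons_of_ne_nil hC.carries.1
  have hnd := h.nodup
  simp only [List.flatMap_cons, List.nodup_append] at hnd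
  obtain ⟨ndB, ⟨ndC, ndl, dCl⟩, dB⟩ := hnd
  have haB : a ∈ B.verts := by simp [hp]
  have hbC : b ∈ C.verts := by simp [hq]
  have hedges : pathEdges (B.link C).verts =
      pathEdges B.verts ++ s(a, b) :: pathEdges C.verts := by
    simp only [Block.link, hp, hq]
    exact pathEdges_append p q a b
  have hab : ∀ x ∈ B.verts, ∀ y ∈ C.verts, x ≠ y := fun x hx y hy =>
    dB x hx y (by simp [hy])
  have hnew : Request.arrive s(a, b) ∉ σ := by
    intro harr
    rcases hBC with hr | hl
    · have := hB.right hr p a hp _ harr (Sym2.mem_mk_left a b)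
      exact hab b (mem_of_mem_pathEdges this (Sym2.mem_mk_right a b)) b hbC rfl
    · have := hC.left hl q.reverse b (by simp [hq]) _ harr (Sym2.mem_mk_right a b)
      have := mem_of_mem_pathEdges this (Sym2.mem_mk_left a b)
      exact hab a haB a (by simpa using this) rfl
  have hpres : ∀ e, e ∈ present σ → e ∈ present (Request.arrive s(a, b) :: σ) := fun e he => by
    simp [present, he]
  have hnewp : s(a, b) ∈ present (Request.arrive s(a, b) :: σ) := by simp [present]
  refine ⟨Request.arrive s(a, b) :: σ, ⟨h.admissible, ?_, hnew⟩, ?_, ?_, ?_⟩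
  · simpa using hab a haB b hbC
  · have := h.nodup
    simpa [Block.link] using this
  · intro e he
    simp only [present, Finset.mem_insert] at he
    rcases he with rfl | he
    · exact ⟨B.link C, by simp, by simp [hedges]⟩
    · obtain ⟨D, hD, heD⟩ := h.cover e he
      simp only [List.mem_cons] at hD
      rcases hD with rfl | rfl | hD
      · exact ⟨_, List.mem_cons_self, by simp [hedges, heD]⟩
      · exact ⟨_, List.mem_cons_self, by simp [hedges, heD]⟩
      · exact ⟨D, by simp [hD], heD⟩
  · intro D hD
    have hmono : ∀ e, edgeType A e σ ≤ edgeType A e (Request.arrive s(a, b) :: σ) := fun e =>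
      edgeType_le_cons A e _ σ
    rcases List.mem_cons.1 hD with rfl | hD
    · have cB := hB.carries.of_imp (fun e _ => hpres e) hmono
      have cC := hC.carries.of_imp (fun e _ => hpres e) hmono
      refine ⟨⟨by simp [Block.link, hp], ?_⟩, ?_, ?_⟩
      · rw [hedges]
        exact List.rel_append cB.2 (.cons ⟨hnewp, Nat.zero_le _⟩ cC.2)
      · intro hl r y hy e he hye
        rw [pathEdges_reverse, hedges]
        simp only [List.mem_cons, Request.arrive.injEq] at he
        rcases he with rfl | he
        · simp
        · obtain ⟨x, B', hB'⟩ := List.exists_cons_of_ne_nil hB.carries.1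
          have hyx : y = x := by
            have h1 := congrArg List.getLast? hy
            simpa [Block.link, hB', List.getLast?_append] using h1.symm
          subst hyx
          have := hB.left hl B'.reverse y (by simp [hB']) e he hye
          rw [pathEdges_reverse, List.mem_reverse] at this
          simp [this]
      · intro hr r y hy e he hye
        rw [hedges]
        simp only [List.mem_cons, Request.arrive.injEq] at he
        rcases he with rfl | he
        · simp
        · obtain ⟨C', x, hC'⟩ := exists_concat hC.carries.1
          have hyx : y = x := by
            have h1 := congrArg List.getLast? hy
            simpa [Block.link, hC', List.getLast?_append] using h1.symm
          subst hyx
          have := hC.right hr C' y hC' e he hye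
          simp [this]
    · have hDl := h.holds D (by simp [hD])
      have hout : ∀ y ∈ D.verts, y ∉ s(a, b) := by
        intro y hy hys
        rcases Sym2.mem_iff.1 hys with rfl | rfl
        · exact dB y haB y (List.mem_append_right _ (List.mem_flatMap.2 ⟨D, hD, hy⟩)) rfl
        · exact dCl y hbC y (List.mem_flatMap.2 ⟨D, hD, hy⟩) rfl
      refine ⟨hDl.carries.of_imp (fun e _ => hpres e) hmono, ?_, ?_⟩
      · intro hl r y hy e he hye
        simp only [List.mem_cons, Request.arrive.injEq] at he
        rcases he with rfl | he
        · have : y ∈ D.verts.reverse := by simp [hy]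
          exact absurd hye (hout y (by simpa using this))
        · exact hDl.left hl r y hy e he hye
      · intro hr r y hy e he hye
        simp only [List.mem_cons, Request.arrive.injEq] at he
        rcases he with rfl | he
        · exact absurd hye (hout y (by simp [hy]))
        · exact hDl.right hr r y hy e he hye

/-- Deleting a rejected inner edge of a block splits it into two blocks. The ends that arise are not
pendant: the deleted edge has arrived at them and may not arrive again. -/
theorem Layout.cut {A : OnlineAlgorithm} {σ : History} {p q b c : List ℕ} {u v x : ℕ}
    {fl fr : Bool} {l : List Block}
    (h : Layout A σ (⟨p ++ [u] ++ v :: q, b ++ x :: c, fl, fr⟩ :: l))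
    (hb : p.length = b.length) (hp : p ≠ []) (hq : q ≠ []) (hA : s(u, v) ∉ A σ) :
    Layout A (Request.depart s(u, v) :: σ)
      (⟨p ++ [u], b, fl, false⟩ :: ⟨v :: q, c, false, fr⟩ :: l) := by
  have hB := h.holds _ List.mem_cons_self
  have hedges := pathEdges_append p q u v
  have hcar := hB.carries.2
  rw [hedges] at hcar
  have hlen : (pathEdges (p ++ [u])).length = b.length := by
    have := length_pathEdges (p := p ++ [u]) (by simp)
    simp only [List.length_append, List.length_singleton] at this
    omega
  have hnd := h.nodup
  simp only [List.flatMap_cons, List.nodup_append] at hnd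
  obtain ⟨⟨nd1, nd2, d12⟩, ndl, dl⟩ := hnd
  have hout : ∀ e, e ≠ s(u, v) → e ∈ present σ →
      e ∈ present (Request.depart s(u, v) :: σ) := fun e he he' => by simp [present, he, he']
  have hne1 : ∀ e ∈ pathEdges (p ++ [u]), e ≠ s(u, v) := by
    rintro e he rfl
    exact d12 v (mem_of_mem_pathEdges he (Sym2.mem_mk_right u v)) v (by simp) rfl
  have hne2 : ∀ e ∈ pathEdges (v :: q), e ≠ s(u, v) := by
    rintro e he rfl
    exact d12 u (by simp) u (mem_of_mem_pathEdges he (Sym2.mem_mk_left u v)) rfl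
  have hmono : ∀ e, edgeType A e σ ≤ edgeType A e (Request.depart s(u, v) :: σ) := fun e =>
    edgeType_le_cons A e _ σ
  have hsplit : List.Forall₂ (fun e y => e ∈ present σ ∧ y ≤ edgeType A e σ)
        (pathEdges (p ++ [u])) b ∧
      List.Forall₂ (fun e y => e ∈ present σ ∧ y ≤ edgeType A e σ)
        (s(u, v) :: pathEdges (v :: q)) (x :: c) := by
    have h1 := List.forall₂_take (pathEdges (p ++ [u])).length hcar
    have h2 := List.forall₂_drop (pathEdges (p ++ [u])).length hcar
    rw [List.take_left, hlen, List.take_left] at h1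
    rw [List.drop_left, hlen, List.drop_left] at h2
    exact ⟨h1, h2⟩
  obtain ⟨s1, s2⟩ := hsplit
  obtain ⟨hx, s2⟩ := List.forall₂_cons.1 s2
  refine ⟨⟨h.admissible, hx.1, hA⟩, ?_, ?_, ?_⟩
  · have := h.nodup
    simpa using this
  · intro e he
    simp only [present, Finset.mem_erase] at he
    obtain ⟨D, hD, heD⟩ := h.cover e he.2
    rcases List.mem_cons.1 hD with rfl | hD
    · simp only [hedges, List.mem_append, List.mem_cons] at heD
      rcases heD with heD | rfl | heD
      · exact ⟨_, List.mem_cons_self, heD⟩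
      · exact absurd rfl he.1
      · exact ⟨_, List.mem_cons_of_mem _ List.mem_cons_self, heD⟩
    · exact ⟨D, by simp [hD], heD⟩
  · intro D hD
    simp only [List.mem_cons] at hD
    rcases hD with rfl | rfl | hD
    · refine ⟨Carries.of_imp (σ := σ) ⟨by simp, s1⟩ (fun e he => hout e (hne1 e he)) hmono,
        ?_, by simp⟩
      intro hl r y hy e he hye
      replace he : Request.arrive e ∈ σ := by simpa using he
      have hy1 : y ∈ p ++ [u] := by
        have : y ∈ (p ++ [u]).reverse := by
          change (p ++ [u]).reverse = r ++ [y] at hy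
          rw [hy]
          simp
        exact List.mem_reverse.1 this
      have := hB.left hl ((v :: q).reverse ++ r) y (by simp_all) e he hye
      rw [pathEdges_reverse, List.mem_reverse, hedges] at this
      rw [pathEdges_reverse, List.mem_reverse]
      simp only [List.mem_append, List.mem_cons] at this
      rcases this with this | rfl | this
      · exact this
      · obtain ⟨a, p', rfl⟩ := List.exists_cons_of_ne_nil hp
        have hya : y = a := by
          have h1 := congrArg List.getLast? hy
          simpa [List.getLast?_append, List.getLast?_cons] using h1.symm
        rcases Sym2.mem_iff.1 hye with rfl | rfl
        · exact absurd hya (fun h => nd1.2.2 a (by simp) y (by simp) h.symm)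
        · exact absurd rfl (d12 y hy1 y (by simp))
      · exact absurd rfl (d12 y hy1 y (mem_of_mem_pathEdges this hye))
    · refine ⟨Carries.of_imp (σ := σ) ⟨by simp, s2⟩ (fun e he => hout e (hne2 e he)) hmono,
        by simp, ?_⟩
      intro hr r y hy e he hye
      replace he : Request.arrive e ∈ σ := by simpa using he
      have hy1 : y ∈ v :: q := by
        change v :: q = r ++ [y] at hy
        rw [hy]
        simp
      have := hB.right hr (p ++ [u] ++ r) y (by simp_all) e he hye
      rw [hedges] at this
      simp only [List.mem_append, List.mem_cons] at this
      rcases this with this | rfl | this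
      · exact absurd rfl (d12 y (by simpa using mem_of_mem_pathEdges this hye) y hy1)
      · obtain ⟨q', a, rfl⟩ := exists_concat hq
        have hya : y = a := by
          have h1 := congrArg List.getLast? hy
          simpa [List.getLast?_append, List.getLast?_cons] using h1.symm
        rcases Sym2.mem_iff.1 hye with rfl | rfl
        · exact absurd rfl (d12 y (by simp) y hy1)
        · exact absurd (hya ▸ by simp) (List.nodup_cons.1 nd2).1
      · exact this
    · have hDl := h.holds D (by simp [hD])
      have hneD : ∀ e ∈ pathEdges D.verts, e ≠ s(u, v) := by
        rintro e he rfl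
        exact dl u (by simp) u
          (List.mem_flatMap.2 ⟨D, hD, mem_of_mem_pathEdges he (Sym2.mem_mk_left u v)⟩) rfl
      refine ⟨hDl.carries.of_imp (fun e he => hout e (hneD e he)) hmono, ?_, ?_⟩
      · intro hl r y hy e he hye
        exact hDl.left hl r y hy e (by simpa using he) hye
      · intro hr r y hy e he hye
        exact hDl.right hr r y hy e (by simpa using he) hye

/-! ### Perfectly matched paths -/

/-- The number of edges of the path `p` that belong to `M`. -/
def hits (M : Finset Edge) (p : List ℕ) : ℕ := (pathEdges p).countP (· ∈ M)

theorem hits_of_mem {M : Finset Edge} (hM : IsMatching M) {u v : ℕ} {p : List ℕ}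
    (hp : (u :: v :: p).Nodup) (huv : s(u, v) ∈ M) :
    hits M (u :: v :: p) = hits M p + 1 ∧ ∀ w q, p = w :: q → s(v, w) ∉ M := by
  have hnext : ∀ w q, p = w :: q → s(v, w) ∉ M := by
    rintro w q rfl hvw
    have := hM _ huv _ hvw v (Sym2.mem_mk_right u v) (Sym2.mem_mk_left v w)
    have hu : u ∈ s(v, w) := this ▸ Sym2.mem_mk_left u v
    rcases Sym2.mem_iff.1 hu with rfl | rfl <;> simp at hp
  refine ⟨?_, hnext⟩
  cases p with
  | nil => simp [hits, pathEdges, huv]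
  | cons w q => simp [hits, pathEdges, huv, hnext w q rfl]

theorem hits_of_notMem {M : Finset Edge} {u v : ℕ} {p : List ℕ} (huv : s(u, v) ∉ M) :
    hits M (u :: v :: p) = hits M (v :: p) := by
  simp [hits, pathEdges, huv]

theorem two_mul_hits_le {M : Finset Edge} (hM : IsMatching M) :
    ∀ p : List ℕ, p.Nodup → 2 * hits M p ≤ p.length
  | [], _ => by simp [hits, pathEdges]
  | [_], _ => by simp [hits, pathEdges]
  | u :: v :: p, h => by
    by_cases huv : s(u, v) ∈ M
    · have h1 := two_mul_hits_le hM p (by simp_all)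
      rw [(hits_of_mem hM h huv).1, List.length_cons, List.length_cons]
      omega
    · have h1 := two_mul_hits_le hM (v :: p) (List.nodup_cons.1 h).2
      rw [hits_of_notMem huv, List.length_cons]
      omega

/-- Lists of odd length that alternate between odd and even numbers, beginning and ending with an
odd number: the types of the edges of a perfectly matched path. -/
inductive Alternating : List ℕ → Prop
  | single {x : ℕ} : Odd x → Alternating [x]
  | cons {x y : ℕ} {t : List ℕ} : Odd x → Even y → Alternating t → Alternating (x :: y :: t)

theorem Alternating.append {t u : List ℕ} {x : ℕ} (ht : Alternating t) (hx : Even x)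
    (hu : Alternating u) : Alternating (t ++ x :: u) := by
  induction ht with
  | single h => exact .cons h hx hu
  | cons h1 h2 _ ih => exact .cons h1 h2 ih

theorem Alternating.reverse {t : List ℕ} (ht : Alternating t) : Alternating t.reverse := by
  induction ht with
  | single h => exact .single h
  | cons h1 h2 _ ih => simpa using ih.append h2 (.single h1)

theorem Alternating.split : ∀ {t u : List ℕ} {x : ℕ}, Alternating (t ++ x :: u) → Odd t.length →
    Alternating t ∧ Even x ∧ Alternating u
  | [], _, _, _, h => by simp at h
  | [a], _, _, h, _ => by
    cases h with
    | cons h1 h2 h3 => exact ⟨.single h1, h2, h3⟩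
  | a :: b :: t, u, x, h, ht => by
    have ht' : Odd t.length := by
      simp only [List.length_cons] at ht
      grind
    cases h with
    | cons h1 h2 h3 =>
      obtain ⟨h4, h5⟩ := Alternating.split h3 ht'
      exact ⟨.cons h1 h2 h4, h5⟩

theorem Alternating.extend {t : List ℕ} (ht : Alternating t) :
    Alternating ((0 :: t ++ [0]).map Nat.succ) := by
  have key : ∀ a, Odd a → Alternating (a :: (t.map Nat.succ ++ [1])) := by
    induction ht with
    | single h => exact fun a ha => .cons ha (by simpa using h.add_one) (.single odd_one)
    | cons h1 h2 _ ih =>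
      exact fun a ha => .cons ha (by simpa using h1.add_one) (ih _ (by simpa using h2.add_one))
  simpa using key 1 odd_one

theorem Alternating.odd_length {t : List ℕ} (ht : Alternating t) : Odd t.length := by
  induction ht with
  | single h => simp
  | cons _ _ _ ih =>
    simp only [List.length_cons]
    grind

/-- A perfectly matched path is matched along every other edge. -/
theorem mem_iff_odd_of_perfect {M : Finset Edge} (hM : IsMatching M) {t : List ℕ}
    (ht : Alternating t) {p : List ℕ} (hp : p.Nodup) (hl : p.length = t.length + 1)
    (hperf : 2 * hits M p = p.length) :
    List.Forall₂ (fun e x => e ∈ M ↔ Odd x) (pathEdges p) t := by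
  have first : ∀ u v q, (u :: v :: q).Nodup → 2 * hits M (u :: v :: q) = (u :: v :: q).length →
      s(u, v) ∈ M := by
    intro u v q hnd h
    by_contra huv
    have h1 := two_mul_hits_le hM (v :: q) (List.nodup_cons.1 hnd).2
    rw [hits_of_notMem huv, List.length_cons] at h
    omega
  induction ht generalizing p with
  | single hx =>
    match p, hl with
    | [u, v], _ => exact .cons (by simpa [hx] using first u v [] hp hperf) .nil
  | cons hx hy _ ih =>
    match p, hl with
    | u :: v :: w :: p, hl =>
      have huv := first _ _ _ hp hperf
      obtain ⟨h1, h2⟩ := hits_of_mem hM hp huv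
      refine .cons (by simpa [hx] using huv) (.cons ?_ (ih ?_ ?_ ?_))
      · simpa [Nat.not_odd_iff_even.2 hy] using h2 w p rfl
      · simp_all
      · simpa using hl
      · rw [h1] at hperf
        simp only [List.length_cons] at hperf ⊢
        omega

/-- On a perfectly matched path the parities of the types are those of `t`, so that lower bounds on
the types that fall short of `t` by one can be raised to `t`. -/
theorem Carries.of_perfect {A : OnlineAlgorithm} (hA : A [] = ∅) {σ : History} {p t : List ℕ}
    (hM : IsMatching (A σ)) (h : Carries A σ p (t.map Nat.pred)) (ht : Alternating t)
    (hp : p.Nodup) (hperf : 2 * hits (A σ) p = p.length) : Carries A σ p t := by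
  have h1 := mem_iff_odd_of_perfect hM ht hp (by simpa using h.length) hperf
  obtain ⟨hne, h2⟩ := h
  rw [List.forall₂_map_right_iff] at h2
  refine ⟨hne, ?_⟩
  clear hperf hp ht hne
  generalize pathEdges p = l at h1 h2 ⊢
  induction h1 with
  | nil => exact .nil
  | @cons e x _ _ hex _ ih =>
    obtain ⟨⟨h3, h4⟩, h5⟩ := List.forall₂_cons.1 h2
    refine .cons ⟨h3, ?_⟩ (ih h5)
    have h6 := odd_edgeType_iff (A := A) (e := e) (by simp [hA]) σ
    rw [hex] at h6
    by_contra hlt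
    have : x = edgeType A e σ + 1 := by
      simp only [Nat.pred_eq_sub_one] at h4
      omega
    rw [this, Nat.odd_add_one] at h6
    exact iff_not_self h6

/-! ### The value of a path for the adversary -/

/-- The size of a perfect matching of a path whose edges carry the bounds `t`. -/
noncomputable def size (t : List ℕ) : ℝ := ((t.length : ℝ) + 1) / 2

/-- The path obtained from `m` single edges of type `1` by linking them to one another and to two
new vertices, after it has been perfectly matched. -/
def chain (m : ℕ) : List ℕ := 1 :: (List.replicate m [2, 1]).flatten

/-- `Worth k ρ R w wt n a b t v`: the adversary has a plan to gain `v` from a path that is a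
component of the current graph and whose edges have at least the types `t` whenever the path is
perfectly matched. A component gains `1` for each edge that its maximum matching has in excess of
the accepted edges and loses `ρ` for each accepted edge. The flags `a` and `b` tell which ends of
the path are pendant. A single edge of type `1` may be deposited with one of `R` banks, the `r`-th
of which credits it with `w r`.

The number `n` makes the play terminate: it exceeds the total of the numbers of what the path is
turned into, and a deposited edge retains at least `wt r`. -/
inductive Worth (k : ℕ) (ρ : ℝ) (R : ℕ) (w : ℕ → ℝ) (wt : ℕ → ℕ) :
    ℕ → Bool → Bool → List ℕ → ℝ → Prop
  /-- The path is left as it is; at worst it is perfectly matched. -/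
  | stay {n a b t v} : v ≤ -ρ * size t → Worth k ρ R w wt n a b t v
  /-- The path cannot be perfectly matched, as the type of an edge would exceed `k`. -/
  | blocked {n a b t v} : (∃ x ∈ t, k < x) → v ≤ 1 - ρ * (size t - 1) → Worth k ρ R w wt n a b t v
  /-- A perfectly matched path is extended by a new pendant edge at each end. Perfectly matching
  the longer path changes the decision on every edge. -/
  | extend {n n' a b t v v'} : Worth k ρ R w wt n true true ((0 :: t ++ [0]).map Nat.succ) v' →
      v ≤ v' → v ≤ 1 - ρ * (size t - 1) → n < n' → Worth k ρ R w wt n' a b t v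
  /-- A rejected edge of a perfectly matched path is deleted. -/
  | cut {n₁ n₂ n a b t₁ x t₂ v₁ v₂ v} : Odd t₁.length → Odd t₂.length →
      Worth k ρ R w wt n₁ a false t₁ v₁ → Worth k ρ R w wt n₂ false b t₂ v₂ → v ≤ v₁ + v₂ →
      v ≤ 1 - ρ * (size (t₁ ++ x :: t₂) - 1) → n₁ + n₂ < n →
      Worth k ρ R w wt n a b (t₁ ++ x :: t₂) v
  /-- A single edge with a pendant end is deposited with the bank `r`. -/
  | deposit {n a r v} : r < R → v ≤ w r → wt r ≤ n → Worth k ρ R w wt n a true [1] v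
  /-- The path is traversed in the opposite direction. -/
  | symm {n n' a b t v} : Worth k ρ R w wt n b a t.reverse v → n < n' → Worth k ρ R w wt n' a b t v

/-- A component of the current graph together with the play that is planned on it. -/
structure Item where
  verts : List ℕ
  types : List ℕ
  left : Bool
  right : Bool
  weight : ℕ
  value : ℝ

/-- The block of an item with the bounds that hold at all times. By parity the types of the edges of
a perfectly matched item are at least one larger wherever these bounds fall short of `types`. -/
def Item.block (it : Item) : Block := ⟨it.verts, it.types.map Nat.pred, it.left, it.right⟩

/-- The block of an item with the bounds that hold when it is perfectly matched. -/
def Item.tight (it : Item) : Block := ⟨it.verts, it.types, it.left, it.right⟩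

/-- The item is perfectly matched after `σ`. -/
def Item.Perfect (A : OnlineAlgorithm) (σ : History) (it : Item) : Prop :=
  2 * hits (A σ) it.verts = it.verts.length

/-- What the item contributes to `OPT - (1 + ρ) * ALG`: the size of its perfect matching, less
`1 + ρ` times the number of its accepted edges. -/
noncomputable def Item.gain (A : OnlineAlgorithm) (ρ : ℝ) (σ : History) (it : Item) : ℝ :=
  size it.types - (1 + ρ) * hits (A σ) it.verts

/-! ### Moves of the adversary -/

theorem Layout.of_verts_eq {A : OnlineAlgorithm} {σ : History} {l l' : List Block}
    (h : Layout A σ l) (hv : l'.map Block.verts = l.map Block.verts)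
    (hl : ∀ B ∈ l', B.Holds A σ) : Layout A σ l' := by
  refine ⟨h.admissible, ?_, fun e he => ?_, hl⟩
  · rw [List.flatMap_def, hv, ← List.flatMap_def]
    exact h.nodup
  · obtain ⟨B, hB, heB⟩ := h.cover e he
    have : B.verts ∈ l'.map Block.verts := hv ▸ List.mem_map_of_mem hB
    obtain ⟨B', hB', h2⟩ := List.mem_map.1 this
    exact ⟨B', hB', h2 ▸ heB⟩

/-- The current graph after `σ` is made up of the items of `l`, each with a valid plan. -/
structure State (A : OnlineAlgorithm) (k : ℕ) (ρ : ℝ) (R : ℕ) (w : ℕ → ℝ) (wt : ℕ → ℕ)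
    (σ : History) (l : List Item) : Prop where
  layout : Layout A σ (l.map Item.block)
  alternating : ∀ it ∈ l, Alternating it.types
  worth : ∀ it ∈ l, Worth k ρ R w wt it.weight it.left it.right it.types it.value

section

variable {A : OnlineAlgorithm} {k : ℕ} {ρ : ℝ} {R : ℕ} {w : ℕ → ℝ} {wt : ℕ → ℕ} {σ : History}

theorem State.perm {l l' : List Item} (h : State A k ρ R w wt σ l) (hl : l.Perm l') :
    State A k ρ R w wt σ l' :=
  ⟨h.layout.perm (hl.map _), fun it hit => h.alternating it (hl.mem_iff.2 hit),
    fun it hit => h.worth it (hl.mem_iff.2 hit)⟩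

theorem Layout.nodup_verts {l : List Block} (h : Layout A σ l) {B : Block} (hB : B ∈ l) :
    B.verts.Nodup :=
  (List.nodup_flatMap.1 h.nodup).1 B hB

/-- The bounds of perfectly matched items can be raised to the types of their plans. -/
theorem Layout.tighten (hA : SolvesWithRecourse k A) {s : List Item} {l : List Block}
    (h : Layout A σ (s.map Item.block ++ l)) (hs : ∀ it ∈ s, Alternating it.types)
    (hp : ∀ it ∈ s, it.Perfect A σ) : Layout A σ (s.map Item.tight ++ l) := by
  refine h.of_verts_eq (by simp [Item.tight, Item.block, Function.comp_def]) fun B hB => ?_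
  rcases List.mem_append.1 hB with hB | hB
  · obtain ⟨it, hit, rfl⟩ := List.mem_map.1 hB
    have hmem : it.block ∈ s.map Item.block ++ l :=
      List.mem_append_left _ (List.mem_map_of_mem hit)
    have h1 := h.holds _ hmem
    have hnil : A [] = ∅ := Finset.subset_empty.1 (hA [] trivial).1
    have hnd : it.verts.Nodup := h.nodup_verts hmem
    exact ⟨h1.carries.of_perfect hnil (hA σ h.admissible).2.1 (hs it hit) hnd (hp it hit),
      h1.left, h1.right⟩
  · exact h.holds B (List.mem_append_right _ hB)

theorem Layout.relax {s : List Item} {l : List Block}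
    (h : Layout A σ (s.map Item.tight ++ l)) : Layout A σ (s.map Item.block ++ l) := by
  refine h.of_verts_eq (by simp [Item.tight, Item.block, Function.comp_def]) fun B hB => ?_
  rcases List.mem_append.1 hB with hB | hB
  · obtain ⟨it, hit, rfl⟩ := List.mem_map.1 hB
    have h1 := h.holds it.tight (List.mem_append_left _ (List.mem_map_of_mem hit))
    refine ⟨h1.carries.mono ?_, h1.left, h1.right⟩
    change List.Forall₂ (· ≤ ·) (it.types.map Nat.pred) it.types
    rw [List.forall₂_map_left_iff, List.forall₂_same]
    exact fun x _ => Nat.pred_le x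
  · exact h.holds B (List.mem_append_right _ hB)

theorem Layout.reverse {B : Block} {l : List Block} (h : Layout A σ (B :: l)) :
    Layout A σ (⟨B.verts.reverse, B.bounds.reverse, B.right, B.left⟩ :: l) := by
  have hB := h.holds B (by simp)
  refine ⟨h.admissible, ?_, ?_, ?_⟩
  · have := h.nodup
    simp only [List.flatMap_cons] at this ⊢
    exact ((List.reverse_perm _).append_right _).nodup_iff.2 this
  · intro e he
    obtain ⟨D, hD, heD⟩ := h.cover e he
    rcases List.mem_cons.1 hD with rfl | hD
    · exact ⟨_, List.mem_cons_self, by simpa [pathEdges_reverse] using heD⟩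
    · exact ⟨D, by simp [hD], heD⟩
  · intro D hD
    rcases List.mem_cons.1 hD with rfl | hD
    · exact ⟨hB.carries.reverse, fun hb => by simpa using hB.right hb, fun ha => hB.left ha⟩
    · exact h.holds D (by simp [hD])

/-- Attaching a new pendant edge at each end of a path. -/
theorem Layout.extend {B : Block} {l : List Block} (h : Layout A σ (B :: l)) :
    ∃ τ p, Layout A τ (⟨p, 0 :: B.bounds ++ [0], true, true⟩ :: l) := by
  obtain ⟨v, h1⟩ := h.exists_vertex
  obtain ⟨τ, h2⟩ := (h1.perm (List.Perm.swap _ _ _)).link (Or.inr rfl)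
  obtain ⟨u, h3⟩ := h2.exists_vertex
  obtain ⟨τ', h4⟩ := h3.link (Or.inl rfl)
  exact ⟨τ', _, h4⟩

/-- Linking single edges with pendant ends to one another and to two new vertices. -/
theorem Layout.chain {s l : List Block} (h : Layout A σ (s ++ l))
    (hs : ∀ B ∈ s, B.bounds = [1] ∧ B.right = true) :
    ∃ τ p, Layout A τ
      (⟨p, 0 :: (List.replicate s.length [1, 0]).flatten, true, true⟩ :: l) := by
  have key : ∃ τ p f, Layout A τ
      (⟨p, (List.replicate s.length [1, 0]).flatten, f, true⟩ :: l) := by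
    induction s generalizing l with
    | nil =>
      obtain ⟨u, h1⟩ := h.exists_vertex
      exact ⟨σ, _, _, h1⟩
    | cons S s ih =>
      obtain ⟨τ, p, f, h1⟩ := ih (l := S :: l) (h.perm List.perm_middle.symm)
        (fun B hB => hs B (by simp [hB]))
      obtain ⟨h2, h3⟩ := hs S (by simp)
      obtain ⟨τ', h4⟩ := (h1.perm (List.Perm.swap _ _ _)).link (Or.inl h3)
      rw [Block.link, h2] at h4
      exact ⟨τ', _, _, h4⟩
  obtain ⟨τ, p, f, h1⟩ := key
  obtain ⟨u, h2⟩ := h1.exists_vertex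
  obtain ⟨τ', h3⟩ := h2.link (Or.inl rfl)
  exact ⟨τ', _, h3⟩

/-- The item is a perfectly matched edge whose plan is to be deposited with the bank `r`. -/
def Item.Deposited (A : OnlineAlgorithm) (w : ℕ → ℝ) (wt : ℕ → ℕ) (σ : History) (r : ℕ)
    (it : Item) : Prop :=
  it.types = [1] ∧ it.right = true ∧ it.value ≤ w r ∧ wt r ≤ it.weight ∧ it.Perfect A σ

theorem exists_split {α : Type*} {p : List α} {n m : ℕ} (h : p.length = n + m + 2) :
    ∃ p₁ u v q, p = p₁ ++ [u] ++ v :: q ∧ p₁.length = n ∧ q.length = m := by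
  have h1 : (p.drop n).length = m + 2 := by rw [List.length_drop]; omega
  match hd : p.drop n, h1 with
  | u :: v :: q, h1 =>
    refine ⟨p.take n, u, v, q, ?_, ?_, by simpa using h1⟩
    · rw [List.append_assoc, List.singleton_append, ← hd, List.take_append_drop]
    · rw [List.length_take]; omega

/-- Unless an item already contributes its value or waits at a bank, the adversary can carry on with
it. -/
theorem State.step (hA : SolvesWithRecourse k A) (hρ : 0 ≤ ρ) (hw : ∀ r < R, w r ≤ 1)
    {it : Item} {l : List Item} (h : State A k ρ R w wt σ (it :: l)) :
    it.value ≤ it.gain A ρ σ ∨ (∃ r < R, it.Deposited A w wt σ r) ∨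
      ∃ τ l', State A k ρ R w wt τ (l' ++ l) ∧ (l'.map Item.weight).sum < it.weight ∧
        it.value ≤ (l'.map Item.value).sum := by
  have hL := h.layout
  obtain ⟨-, hM, hk⟩ := hA σ hL.admissible
  have hB := hL.holds it.block (by simp)
  have hnd : it.verts.Nodup := hL.nodup_verts (B := it.block) (by simp)
  have hlen : it.verts.length = it.types.length + 1 := by simpa [Item.block] using hB.carries.length
  have halt := h.alternating it (by simp)
  have hle := two_mul_hits_le hM it.verts hnd
  have hsz : 2 * size it.types = (it.verts.length : ℝ) := by
    rw [hlen, size]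
    push_cast
    ring
  -- An item that is not perfectly matched misses at least one edge, as it has evenly many vertices.
  have hdef : ∀ {v : ℝ}, v ≤ 1 - ρ * (size it.types - 1) → ¬ it.Perfect A σ →
      v ≤ it.gain A ρ σ := by
    intro v hv hperf
    have h1 : 2 * hits (A σ) it.verts + 2 ≤ it.verts.length := by
      obtain ⟨c, hc⟩ := halt.odd_length
      unfold Item.Perfect at hperf
      omega
    have h2 : 2 * (hits (A σ) it.verts : ℝ) + 2 ≤ it.verts.length := by exact_mod_cast h1
    unfold Item.gain
    nlinarith
  have htight := fun hperf : it.Perfect A σ =>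
    Layout.tighten (s := [it]) hA hL (by simpa using halt) (by simpa using hperf)
  have hW := h.worth it (by simp)
  have rest_alt : ∀ i ∈ l, Alternating i.types := fun i hi => h.alternating i (by simp [hi])
  have rest_worth := fun i (hi : i ∈ l) => h.worth i (by simp [hi])
  obtain ⟨p, t, a, b, n, v⟩ := it
  dsimp only at hlen halt hle hsz hdef hW hnd
  cases hW with
  | stay hv =>
    left
    have h2 : 2 * (hits (A σ) p : ℝ) ≤ p.length := by exact_mod_cast hle
    simp only [Item.gain]
    nlinarith
  | blocked hx hv =>
    left
    refine hdef hv fun hperf => ?_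
    obtain ⟨x, hx, hkx⟩ := hx
    obtain ⟨-, hc⟩ := ((htight hperf).holds _ List.mem_cons_self).carries
    obtain ⟨i, hi, rfl⟩ := List.getElem_of_mem hx
    have h4 := ((List.forall₂_iff_get.1 hc).2 i (by rw [hc.length_eq]; exact hi) hi).2
    exact absurd (h4.trans (hk _)) (not_le.2 hkx)
  | @extend n' _ _ _ _ _ v' hW' hv hv' hn =>
    by_cases hperf : Item.Perfect A σ ⟨p, t, a, b, n, v⟩
    · right; right
      obtain ⟨τ, q, h1⟩ := (htight hperf).extend
      refine ⟨τ, [⟨q, (0 :: t ++ [0]).map Nat.succ, true, true, n', v'⟩], ⟨?_, ?_, ?_⟩, ?_, ?_⟩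
      · simpa [Item.block, Item.tight, Function.comp_def] using h1
      · simp only [List.singleton_append, List.mem_cons, forall_eq_or_imp]
        exact ⟨halt.extend, rest_alt⟩
      · simp only [List.singleton_append, List.mem_cons, forall_eq_or_imp]
        exact ⟨hW', rest_worth⟩
      · simpa using hn
      · simpa using hv
    · exact Or.inl (hdef hv' hperf)
  | @cut n₁ n₂ _ _ _ t₁ x t₂ v₁ v₂ _ ht₁ ht₂ hW₁ hW₂ hv hv' hn =>
    by_cases hperf : Item.Perfect A σ ⟨p, t₁ ++ x :: t₂, a, b, n, v⟩
    · right; right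
      obtain ⟨halt₁, hx, halt₂⟩ := halt.split ht₁
      obtain ⟨p₁, u, y, q, rfl, hp₁, hq⟩ := exists_split (p := p) (n := t₁.length)
        (m := t₂.length) (by simp only [hlen, List.length_append, List.length_cons]; omega)
      have hnot : s(u, y) ∉ A σ := by
        have h1 := mem_iff_odd_of_perfect hM halt hnd hlen hperf
        rw [pathEdges_append] at h1
        have h2 : (pathEdges (p₁ ++ [u])).length = t₁.length := by
          have := length_pathEdges (p := p₁ ++ [u]) (by simp)
          simp only [List.length_append, List.length_singleton] at this
          omega
        have h3 := List.forall₂_drop t₁.length h1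
        rw [← h2, List.drop_left, h2, List.drop_left] at h3
        rw [(List.forall₂_cons.1 h3).1]
        exact Nat.not_odd_iff_even.2 hx
      have h1 := Layout.cut (htight hperf) hp₁
        (by rintro rfl; rw [← hp₁] at ht₁; simp at ht₁)
        (by rintro rfl; rw [← hq] at ht₂; simp at ht₂) hnot
      have h2 := Layout.relax (s := [⟨p₁ ++ [u], t₁, a, false, n₁, v₁⟩,
        ⟨y :: q, t₂, false, b, n₂, v₂⟩]) h1
      refine ⟨_, [⟨p₁ ++ [u], t₁, a, false, n₁, v₁⟩, ⟨y :: q, t₂, false, b, n₂, v₂⟩],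
        ⟨by simpa using h2, ?_, ?_⟩, ?_, ?_⟩
      · simp only [List.cons_append, List.nil_append, List.mem_cons, forall_eq_or_imp]
        exact ⟨halt₁, halt₂, rest_alt⟩
      · simp only [List.cons_append, List.nil_append, List.mem_cons, forall_eq_or_imp]
        exact ⟨hW₁, hW₂, rest_worth⟩
      · simpa using hn
      · simpa using hv
    · exact Or.inl (hdef hv' hperf)
  | @deposit _ _ r _ hr hv hn =>
    by_cases hperf : Item.Perfect A σ ⟨p, [1], a, true, n, v⟩
    · exact Or.inr (Or.inl ⟨r, hr, rfl, rfl, hv, hn, hperf⟩)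
    · refine Or.inl (hdef (hv.trans ((hw r hr).trans ?_)) hperf)
      norm_num [size]
  | @symm n' _ _ _ _ _ hW' hn =>
    right; right
    refine ⟨σ, [⟨p.reverse, t.reverse, b, a, n', v⟩], ⟨?_, ?_, ?_⟩, by simpa using hn, by simp⟩
    · have := Layout.reverse hL
      simpa [Item.block, List.map_reverse] using this
    · simp only [List.singleton_append, List.mem_cons, forall_eq_or_imp]
      exact ⟨halt.reverse, rest_alt⟩
    · simp only [List.singleton_append, List.mem_cons, forall_eq_or_imp]
      exact ⟨hW', rest_worth⟩

end

/-! ### The lower bound from plans of positive value -/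

section

variable {A : OnlineAlgorithm} {k : ℕ} {ρ : ℝ} {R : ℕ} {w : ℕ → ℝ} {wt m : ℕ → ℕ} {σ : History}

theorem alternating_chain (n : ℕ) : Alternating (chain n) := by
  induction n with
  | zero => exact .single odd_one
  | succ n ih => exact .cons odd_one even_two ih

theorem map_pred_chain (n : ℕ) :
    (chain n).map Nat.pred = 0 :: (List.replicate n [1, 0]).flatten := by
  simp [chain, List.map_flatten]

open scoped Classical in
/-- As soon as `m r` edges wait at the bank `r`, they are joined to a single path. -/
theorem State.withdraw (hA : SolvesWithRecourse k A) {l : List Item}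
    (h : State A k ρ R w wt σ l) {r n : ℕ} (hn : n < m r * wt r)
    (hW : Worth k ρ R w wt n true true (chain (m r)) (m r * w r))
    (hl : m r ≤ l.countP (fun it => it.Deposited A w wt σ r)) :
    ∃ τ l', State A k ρ R w wt τ l' ∧ (l'.map Item.weight).sum < (l.map Item.weight).sum ∧
      (l.map Item.value).sum ≤ (l'.map Item.value).sum := by
  obtain ⟨s, rest, hperm, hs, hlen⟩ : ∃ s rest, l.Perm (s ++ rest) ∧
      (∀ it ∈ s, it.Deposited A w wt σ r) ∧ s.length = m r := by
    refine ⟨(l.filter (fun it => it.Deposited A w wt σ r)).take (m r),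
      (l.filter (fun it => it.Deposited A w wt σ r)).drop (m r) ++
        l.filter (fun it => ! decide (it.Deposited A w wt σ r)), ?_, ?_, ?_⟩
    · rw [← List.append_assoc, List.take_append_drop]
      exact (List.filter_append_perm _ l).symm
    · intro it hit
      simpa using (List.mem_filter.1 (List.mem_of_mem_take hit)).2
    · rw [List.length_take, ← List.countP_eq_length_filter]
      exact min_eq_left hl
  have h' := h.perm hperm
  have hL := h'.layout
  rw [List.map_append] at hL
  have h1 := Layout.tighten hA hL (fun it hit => h'.alternating it (by simp [hit]))
    (fun it hit => (hs it hit).2.2.2.2)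
  obtain ⟨τ, p, h2⟩ := h1.chain (fun B hB => by
    obtain ⟨it, hit, rfl⟩ := List.mem_map.1 hB
    exact ⟨(hs it hit).1, (hs it hit).2.1⟩)
  rw [List.length_map, hlen, ← map_pred_chain] at h2
  refine ⟨τ, ⟨p, chain (m r), true, true, n, m r * w r⟩ :: rest, ⟨h2, ?_, ?_⟩, ?_, ?_⟩
  · simp only [List.mem_cons, forall_eq_or_imp]
    exact ⟨alternating_chain _, fun i hi => h'.alternating i (by simp [hi])⟩
  · simp only [List.mem_cons, forall_eq_or_imp]
    exact ⟨hW, fun i hi => h'.worth i (by simp [hi])⟩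
  · rw [(hperm.map Item.weight).sum_eq]
    have h3 := List.card_nsmul_le_sum (s.map Item.weight) (wt r) (by
      intro x hx
      obtain ⟨it, hit, rfl⟩ := List.mem_map.1 hx
      exact (hs it hit).2.2.2.1)
    simp only [List.length_map, hlen, smul_eq_mul] at h3
    simp only [List.map_append, List.sum_append, List.map_cons, List.sum_cons]
    omega
  · rw [(hperm.map Item.value).sum_eq]
    have h3 := List.sum_le_card_nsmul (s.map Item.value) (w r) (by
      intro x hx
      obtain ⟨it, hit, rfl⟩ := List.mem_map.1 hx
      exact (hs it hit).2.2.1)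
    simp only [List.length_map, hlen, nsmul_eq_mul] at h3
    simp only [List.map_append, List.sum_append, List.map_cons, List.sum_cons]
    linarith

theorem State.length_verts {l : List Item} (h : State A k ρ R w wt σ l) {it : Item}
    (hit : it ∈ l) : it.verts.length = it.types.length + 1 := by
  simpa [Item.block] using
    (h.layout.holds it.block (List.mem_map_of_mem hit)).carries.length

theorem pairs_flatMap {l : List Item} (hl : ∀ it ∈ l, Even it.verts.length) :
    pairs (l.flatMap Item.verts) = l.flatMap fun it => pairs it.verts := by
  induction l with
  | nil => rfl
  | cons it l ih =>
    rw [List.flatMap_cons, List.flatMap_cons, pairs_append _ _ (hl it (by simp)),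
      ih fun i hi => hl i (by simp [hi])]

/-- The perfect matchings of all items together form a matching, and all accepted edges lie on
items: hence the total gain is at most `OPT - (1 + ρ) * ALG`, which is not positive. -/
theorem State.sum_gain_le {c : ℝ} (hc : 0 < c) (hcρ : c < 1 + ρ)
    (hcomp : ∀ τ, Admissible A τ → (opt (present τ) : ℝ) / c ≤ ((A τ).card : ℝ))
    (hA : SolvesWithRecourse k A) {l : List Item} (h : State A k ρ R w wt σ l) :
    (l.map (Item.gain A ρ σ)).sum ≤ 0 := by
  have hL := h.layout
  obtain ⟨hsub, -, -⟩ := hA σ hL.admissible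
  have hflat : (l.map Item.block).flatMap Block.verts = l.flatMap Item.verts := by
    simp [List.flatMap_map, Item.block]
  have hnd : (l.flatMap Item.verts).Nodup := hflat ▸ hL.nodup
  have heven : ∀ it ∈ l, Even it.verts.length := fun it hit => by
    rw [h.length_verts hit]
    exact (h.alternating it hit).odd_length.add_one
  -- The even edges of all items form a matching.
  have hopt : (l.map fun it => size it.types).sum ≤ (opt (present σ) : ℝ) := by
    have h1 : (pairs (l.flatMap Item.verts)).toFinset.card ≤ opt (present σ) := by
      refine card_le_opt (isMatching_pairs hnd) fun e he => ?_
      rw [List.mem_toFinset, pairs_flatMap heven, List.mem_flatMap] at he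
      obtain ⟨it, hit, he⟩ := he
      exact (hL.holds it.block (List.mem_map_of_mem hit)).carries.mem_present
        (pairs_subset_pathEdges _ he)
    rw [List.toFinset_card_of_nodup (nodup_pairs hnd), pairs_flatMap heven,
      List.length_flatMap] at h1
    refine le_trans (le_of_eq ?_) (Nat.cast_le.2 h1)
    rw [Nat.cast_list_sum, List.map_map]
    refine congrArg List.sum (List.map_congr_left fun it hit => ?_)
    have h2 := h.length_verts hit
    obtain ⟨d, hd⟩ := (h.alternating it hit).odd_length
    have h3 : it.verts.length / 2 = d + 1 := by omega
    simp only [Function.comp_apply, length_pairs, h3, size, hd]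
    push_cast
    ring
  have halg : ((A σ).card : ℝ) ≤ (l.map fun it => (hits (A σ) it.verts : ℝ)).sum := by
    have h1 : (A σ).card ≤ ((l.flatMap fun it => pathEdges it.verts).filter
        (· ∈ A σ)).length := by
      refine le_trans (Finset.card_le_card fun e he => ?_) (List.toFinset_card_le _)
      obtain ⟨B, hB, heB⟩ := hL.cover e (hsub he)
      obtain ⟨it, hit, rfl⟩ := List.mem_map.1 hB
      simp only [List.mem_toFinset, List.mem_filter, List.mem_flatMap, decide_eq_true_eq]
      exact ⟨⟨it, hit, heB⟩, he⟩
    rw [← List.countP_eq_length_filter, List.countP_flatMap] at h1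
    refine (Nat.cast_le.2 h1).trans (le_of_eq ?_)
    rw [Nat.cast_list_sum, List.map_map]
    rfl
  have hsum : (l.map (Item.gain A ρ σ)).sum = (l.map fun it => size it.types).sum -
      (1 + ρ) * (l.map fun it => (hits (A σ) it.verts : ℝ)).sum := by
    clear hopt halg heven hnd hflat hL h
    induction l with
    | nil => simp
    | cons it l ih =>
      simp only [List.map_cons, List.sum_cons, ih, Item.gain]
      ring
  have h1 := (div_le_iff₀ hc).1 (hcomp σ hL.admissible)
  have h2 : (0 : ℝ) ≤ (A σ).card := Nat.cast_nonneg _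
  rw [hsum]
  nlinarith

open scoped Classical in
theorem sum_value_le {l : List Item} {B : ℕ → ℝ}
    (hl : ∀ it ∈ l, it.value ≤ it.gain A ρ σ +
      ∑ r ∈ Finset.range R, if it.Deposited A w wt σ r then B r else 0) :
    (l.map Item.value).sum ≤ (l.map (Item.gain A ρ σ)).sum +
      ∑ r ∈ Finset.range R, (l.countP (fun it => it.Deposited A w wt σ r) : ℝ) * B r := by
  induction l with
  | nil => simp
  | cons it l ih =>
    have h1 := hl it (by simp)
    have h2 := ih fun i hi => hl i (by simp [hi])
    have h3 : ∑ r ∈ Finset.range R,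
        ((it :: l).countP (fun it => it.Deposited A w wt σ r) : ℝ) * B r =
        (∑ r ∈ Finset.range R, if it.Deposited A w wt σ r then B r else 0) +
        ∑ r ∈ Finset.range R, (l.countP (fun it => it.Deposited A w wt σ r) : ℝ) * B r := by
      rw [← Finset.sum_add_distrib]
      refine Finset.sum_congr rfl fun r _ => ?_
      by_cases hr : it.Deposited A w wt σ r
      · simp [hr]
        ring
      · simp [hr]
    rw [h3]
    simp only [List.map_cons, List.sum_cons]
    linarith

/-- No state of sufficient value can be reached if the algorithm is better than
`(1 + ρ)`-competitive: when no item can be played on, fewer than `m r` edges wait at the bank `r`,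
so that the value is realized up to a constant. -/
theorem State.false {c : ℝ} (hc : 0 < c) (hcρ : c < 1 + ρ)
    (hcomp : ∀ τ, Admissible A τ → (opt (present τ) : ℝ) / c ≤ ((A τ).card : ℝ))
    (hA : SolvesWithRecourse k A) (hρ : 0 ≤ ρ) (hw : ∀ r < R, -ρ ≤ w r ∧ w r ≤ 1)
    (hbank : ∀ r < R, ∃ n < m r * wt r, Worth k ρ R w wt n true true (chain (m r)) (m r * w r))
    {l : List Item} (h : State A k ρ R w wt σ l)
    (hv : ∑ r ∈ Finset.range R, m r * (w r + ρ) < (l.map Item.value).sum) : False := by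
  classical
  induction hN : (l.map Item.weight).sum using Nat.strong_induction_on generalizing σ l with
  | _ N ih =>
  by_cases hprog : ∃ τ l', State A k ρ R w wt τ l' ∧
      (l'.map Item.weight).sum < (l.map Item.weight).sum ∧
      (l.map Item.value).sum ≤ (l'.map Item.value).sum
  · obtain ⟨τ, l', h1, h2, h3⟩ := hprog
    exact ih _ (hN ▸ h2) h1 (hv.trans_le h3) rfl
  · have hcount : ∀ r < R, l.countP (fun it => it.Deposited A w wt σ r) ≤ m r := by
      intro r hr
      by_contra hlt
      obtain ⟨n, hn, hW⟩ := hbank r hr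
      exact hprog (h.withdraw hA hn hW (not_le.1 hlt).le)
    have hval : ∀ it ∈ l, it.value ≤ it.gain A ρ σ +
        ∑ r ∈ Finset.range R, if it.Deposited A w wt σ r then w r + ρ else 0 := by
      intro it hit
      have hnonneg : ∀ r ∈ Finset.range R,
          (0 : ℝ) ≤ if it.Deposited A w wt σ r then w r + ρ else 0 := by
        intro r hr
        have := (hw r (Finset.mem_range.1 hr)).1
        split_ifs
        · linarith
        · exact le_rfl
      obtain ⟨l₁, l₂, rfl⟩ := List.append_of_mem hit
      have h' := h.perm List.perm_middle
      rcases h'.step hA hρ (fun r hr => (hw r hr).2) with h1 | ⟨r, hr, h1⟩ | ⟨τ, l', h1, h2, h3⟩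
      · have := Finset.sum_nonneg hnonneg
        linarith
      · have h2 := Finset.single_le_sum hnonneg (Finset.mem_range.2 hr)
        rw [if_pos h1] at h2
        have h3 := h.length_verts hit
        obtain ⟨h4, -, h5, -, h6⟩ := h1
        unfold Item.Perfect at h6
        rw [h3, h4] at h6
        have h7 : hits (A σ) it.verts = 1 := by
          simp only [List.length_singleton] at h6
          omega
        -- A waiting edge is accepted and falls short of its credit by `w r + ρ`.
        have h8 : it.gain A ρ σ = -ρ := by
          rw [Item.gain, h4, h7]
          norm_num [size]
        linarith
      · refine absurd ⟨τ, l' ++ (l₁ ++ l₂), h1, ?_, ?_⟩ hprog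
        · simp only [List.map_append, List.sum_append, List.map_cons, List.sum_cons]
          omega
        · simp only [List.map_append, List.sum_append, List.map_cons, List.sum_cons]
          linarith
    have h1 := sum_value_le hval
    have h2 := h.sum_gain_le hc hcρ hcomp hA
    have h3 : ∑ r ∈ Finset.range R,
        (l.countP (fun it => it.Deposited A w wt σ r) : ℝ) * (w r + ρ) ≤
        ∑ r ∈ Finset.range R, m r * (w r + ρ) := by
      refine Finset.sum_le_sum fun r hr => ?_
      have hr' := Finset.mem_range.1 hr
      exact mul_le_mul_of_nonneg_right (by exact_mod_cast hcount r hr')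
        (by linarith [(hw r hr').1])
    linarith

/-- A single new edge can be added to every state. -/
theorem State.exists_cons {l : List Item} (h : State A k ρ R w wt σ l) {n : ℕ} {v : ℝ}
    (hW : Worth k ρ R w wt n true true [1] v) :
    ∃ τ p, State A k ρ R w wt τ (⟨p, [1], true, true, n, v⟩ :: l) := by
  obtain ⟨y, h1⟩ := h.layout.exists_vertex
  obtain ⟨x, h2⟩ := h1.exists_vertex
  obtain ⟨τ, h3⟩ := h2.link (Or.inl rfl)
  refine ⟨τ, [x] ++ [y], h3, ?_, ?_⟩
  · simp only [List.mem_cons, forall_eq_or_imp]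
    exact ⟨.single odd_one, h.alternating⟩
  · simp only [List.mem_cons, forall_eq_or_imp]
    exact ⟨hW, h.worth⟩

/-- If single edges have plans of positive value, and every bank can afford what it credits, then no
algorithm is better than `(1 + ρ)`-competitive: a large number of single edges is worth more than
what can remain at the banks. -/
theorem not_isCompetitive {c : ℝ} (hcρ : c < 1 + ρ) (hA : SolvesWithRecourse k A) (hρ : 0 ≤ ρ)
    (hw : ∀ r < R, -ρ ≤ w r ∧ w r ≤ 1)
    (hbank : ∀ r < R, ∃ n < m r * wt r, Worth k ρ R w wt n true true (chain (m r)) (m r * w r))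
    {n : ℕ} {v : ℝ} (hv : 0 < v) (hW : Worth k ρ R w wt n true true [1] v) :
    ¬ IsCompetitive A c := by
  rintro ⟨hc, hcomp⟩
  have hstart : ∀ N : ℕ, ∃ σ l, State A k ρ R w wt σ l ∧ (l.map Item.value).sum = N * v := by
    intro N
    induction N with
    | zero =>
      exact ⟨[], [], ⟨⟨trivial, by simp, by simp [present], by simp⟩, by simp, by simp⟩, by simp⟩
    | succ N ih =>
      obtain ⟨σ, l, h1, h2⟩ := ih
      obtain ⟨τ, p, h3⟩ := h1.exists_cons hW
      refine ⟨τ, _, h3, ?_⟩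
      simp only [List.map_cons, List.sum_cons, h2]
      push_cast
      ring
  obtain ⟨N, hN⟩ := exists_nat_gt ((∑ r ∈ Finset.range R, m r * (w r + ρ)) / v)
  obtain ⟨σ, l, h1, h2⟩ := hstart N
  exact h1.false hc hcρ hcomp hA hρ hw hbank (h2 ▸ (div_lt_iff₀ hv).1 hN)

end

/-! ### Plans for recourse at least six -/

section

variable {ρ : ℝ} {R : ℕ} {w : ℕ → ℝ} {wt : ℕ → ℕ}

theorem map_succ_range' (s n : ℕ) :
    (List.range' s n).map Nat.succ = List.range' (s + 1) n := by
  induction n generalizing s with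
  | zero => rfl
  | succ n ih => simp [List.range'_succ, ih]

theorem extend_range' (n : ℕ) (l : List ℕ) :
    (0 :: (List.range' 1 n ++ l) ++ [0]).map Nat.succ =
      List.range' 1 (n + 1) ++ (l.map Nat.succ ++ [1]) := by
  have h : List.range' 1 (n + 1) = (0 :: List.range' 1 n).map Nat.succ := by
    rw [← map_succ_range' 0, List.range'_succ]
  rw [h]
  simp

/-- A path `1, 2, …, k - 1` is extended once. If the new edges are accepted, its end
`k - 1, k, 1` is cut off, in which the edge of type `k` is rejected for good. -/
theorem Worth.long {j n : ℕ} (hj : Odd j) (hρ : 0 ≤ ρ) {a b : Bool} {h v : ℝ}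
    (hW : Worth (j + 3) ρ R w wt n true false (List.range' 1 j) h)
    (hv : v ≤ 1 - 2 * ρ + h) (hv' : v ≤ 1 - ρ * ((j + 3) / 2)) :
    Worth (j + 3) ρ R w wt (n + 3) a b (List.range' 1 (j + 2)) v := by
  -- Here `k = j + 3`: extending `k - 1, k, 1` would require the type `k + 1`.
  have hend : Worth (j + 3) ρ R w wt 1 false true [j + 2, j + 3, 1] (1 - 2 * ρ) := by
    refine .extend (n := 0) (v' := 1 - 2 * ρ) (.blocked ⟨j + 4, by simp, by omega⟩ ?_) le_rfl ?_
      one_pos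
    · norm_num [size]
      linarith
    · norm_num [size]
      linarith
  refine .extend (n := n + 2) (v' := v) ?_ le_rfl ?_ (by omega)
  · have hlist : (0 :: List.range' 1 (j + 2) ++ [0]).map Nat.succ =
        List.range' 1 j ++ (j + 1) :: [j + 2, j + 3, 1] := by
      have h1 := extend_range' (j + 2) []
      rw [List.append_nil, ← List.range'_append_1 (s := 1) (m := j) (n := 3)] at h1
      rw [h1, List.append_assoc]
      simp [List.range'_succ]
      omega
    rw [hlist]
    refine .cut (by simpa using hj) ⟨1, rfl⟩ hW hend (by linarith) ?_ (by omega)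
    convert hv' using 3
    simp only [size, List.length_append, List.length_range', List.length_cons, List.length_nil]
    push_cast
    ring
  · refine hv'.trans ?_
    simp only [size, List.length_range']
    push_cast
    nlinarith

/-- A path `1, 2, …, k - 3` is extended twice, and a single edge is cut off. -/
theorem Worth.short {j n n' : ℕ} (hj : Odd j) (hρ : 0 ≤ ρ) {a b : Bool} {h s v : ℝ}
    (hW : Worth (j + 3) ρ R w wt n true false (List.range' 1 (j + 2)) h)
    (hs : Worth (j + 3) ρ R w wt n' false true [1] s)
    (hv : v ≤ h + s) (hv' : v ≤ 1 - ρ * ((j + 3) / 2)) :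
    Worth (j + 3) ρ R w wt (n + n' + 3) a b (List.range' 1 j) v := by
  refine .extend (n := n + n' + 2) (v' := v) ?_ le_rfl ?_ (by omega)
  · have h1 := extend_range' j []
    rw [List.append_nil] at h1
    rw [h1]
    refine .extend (n := n + n' + 1) (v' := v) ?_ le_rfl ?_ (by omega)
    · rw [extend_range' (j + 1)]
      refine .cut (x := 2) (t₂ := [1]) (by rw [List.length_range']; exact hj.add_even even_two)
        ⟨0, rfl⟩ hW hs hv ?_ (by omega)
      convert hv' using 3
      simp only [size, List.length_append, List.length_range', List.length_cons, List.length_nil]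
      push_cast
      ring
    · refine hv'.trans ?_
      simp [size]
      nlinarith
  · refine hv'.trans ?_
    simp only [size, List.length_range']
    nlinarith

/-- A single edge is extended to a path `1, 2, …, k - 2, …, 2, 1`, which is cut into two halves. -/
theorem Worth.single {j n : ℕ} (hj : Odd j) (hρ : 0 ≤ ρ) {h v : ℝ}
    (hW : Worth (j + 3) ρ R w wt n true false (List.range' 1 j) h)
    (hv : v ≤ 2 * h) (hv' : v ≤ 1 - ρ * j) :
    ∃ n', ∀ a b, Worth (j + 3) ρ R w wt n' a b [1] v := by
  have hsize : ∀ i : ℕ, size (List.range' 1 (i + 1) ++ (List.range' 1 i).reverse) = i + 1 := by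
    intro i
    simp only [size, List.length_append, List.length_reverse, List.length_range']
    push_cast
    ring
  have hstep : ∀ i : ℕ,
      (0 :: (List.range' 1 (i + 1) ++ (List.range' 1 i).reverse) ++ [0]).map Nat.succ =
        List.range' 1 (i + 2) ++ (List.range' 1 (i + 1)).reverse := by
    intro i
    have h : List.range' 1 (i + 1) = (0 :: List.range' 1 i).map Nat.succ := by
      rw [← map_succ_range' 0, List.range'_succ]
    rw [extend_range' (i + 1), List.map_reverse, h]
    simp
  have hbound : ∀ i : ℕ, i ≤ j →
      v ≤ 1 - ρ * (size (List.range' 1 (i + 1) ++ (List.range' 1 i).reverse) - 1) := by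
    intro i hi
    have : (i : ℝ) ≤ j := by exact_mod_cast hi
    rw [hsize]
    nlinarith
  have key : ∀ d i, i + d = j → ∃ n', Worth (j + 3) ρ R w wt n' true true
      (List.range' 1 (i + 1) ++ (List.range' 1 i).reverse) v := by
    intro d
    induction d with
    | zero =>
      rintro i rfl
      have hlist : List.range' 1 (i + 1) ++ (List.range' 1 i).reverse =
          List.range' 1 i ++ (i + 1) :: (List.range' 1 i).reverse := by
        rw [← List.range'_append_1 (s := 1) (m := i) (n := 1)]
        simp [add_comm]
      have h1 := hbound i le_rfl
      rw [hlist] at h1 ⊢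
      exact ⟨n + (n + 1) + 1, .cut (by simpa using hj) (by simpa using hj) hW
        (.symm (n := n) (by simpa using hW) (Nat.lt_succ_self n)) (by linarith) h1
        (Nat.lt_succ_self _)⟩
    | succ d ih =>
      intro i hi
      obtain ⟨n', h1⟩ := ih (i + 1) (by omega)
      exact ⟨n' + 1, .extend (by rw [hstep]; exact h1) le_rfl (hbound i (by omega))
        (Nat.lt_succ_self n')⟩
  obtain ⟨d, rfl⟩ : ∃ d, j = 1 + d := ⟨j - 1, by have := hj.pos; omega⟩
  obtain ⟨n', h1⟩ := key d 1 rfl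
  exact ⟨n' + 1, fun a b => .extend h1 le_rfl (hbound 0 (Nat.zero_le _)) (Nat.lt_succ_self n')⟩

/-- For `k = j + 3 ≥ 6` no bank is needed: improving the plans for the paths `1, …, k - 1` and
`1, …, k - 3` and for single edges in turn makes a single edge worth a positive amount. -/
theorem exists_worth_pos {j : ℕ} (hj : Odd j) (hj3 : 3 ≤ j)
    (hρ : ρ * ((j + 3) ^ 2 - 4 * (j + 3) + 7) = j + 2) :
    ∃ n v, 0 < v ∧ Worth (j + 3) ρ R w wt n true true [1] v := by
  have hj3' : (3 : ℝ) ≤ j := by exact_mod_cast hj3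
  have hD : (0 : ℝ) < (j + 3) ^ 2 - 4 * (j + 3) + 7 := by nlinarith
  have hρ0 : 0 < ρ := by
    by_contra h
    nlinarith [mul_nonneg (neg_nonneg.2 (not_lt.1 h)) hD.le]
  have h1 : 7 * ρ ≤ 2 := by
    by_contra h
    nlinarith [mul_pos (sub_pos.2 (not_le.1 h)) hD]
  have h2 : ρ * j < 1 := by
    by_contra h
    nlinarith [mul_nonneg (sub_nonneg.2 (not_lt.1 h)) hD.le]
  have h3 : ρ * (3 * j + 13) < 6 := by
    by_contra h
    nlinarith [mul_nonneg (sub_nonneg.2 (not_lt.1 h)) hD.le]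
  -- `ε` bounds what the path `1, …, k - 1` can be worth: its extension may be left imperfect.
  set ε : ℝ := 1 - ρ * ((j + 3) / 2) with hε
  have hε0 : 0 < ε := by
    rw [hε]
    nlinarith
  have hε1 : 0 < 3 * ε - 2 * ρ := by
    rw [hε]
    linarith
  have stay : ∀ a b, Worth (j + 3) ρ R w wt 0 a b [1] (-ρ) := fun a b =>
    .stay (by norm_num [size])
  -- Plans for `1, …, k - 3` are called `a`, those for `1, …, k - 1` are called `b`. Each round
  -- gains `1 - 3 * ρ ≥ ρ / 2` until `b` reaches `ε`.
  have a0 : Worth (j + 3) ρ R w wt 0 true false (List.range' 1 j) (-ρ * ((j + 1) / 2)) :=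
    .stay (by simp [size])
  have b0 := Worth.long (a := true) (b := false) (v := ε - ρ) hj hρ0.le a0
    (by rw [hε]; linarith) (by linarith)
  have a1 := Worth.short (a := true) (b := false) (v := ε - 2 * ρ) hj hρ0.le b0 (stay _ _)
    (by linarith) (by linarith)
  have b1 := Worth.long (a := true) (b := false) (v := ε - ρ / 2) hj hρ0.le a1
    (by linarith) (by linarith)
  have a2 := Worth.short (a := true) (b := false) (v := ε - 3 * ρ / 2) hj hρ0.le b1 (stay _ _)
    (by linarith) (by linarith)
  have b2 := Worth.long (a := true) (b := false) (v := ε) hj hρ0.le a2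
    (by linarith) (by linarith)
  have a3 := Worth.short (a := true) (b := false) (v := ε - ρ) hj hρ0.le b2 (stay _ _)
    (by linarith) (by linarith)
  -- Single edges are now worth more than `-ρ`, which improves the plans once more.
  obtain ⟨_, s1⟩ := Worth.single (v := min (2 * (ε - ρ)) 0) hj hρ0.le a3 (min_le_left _ _)
    ((min_le_right _ _).trans (by linarith))
  have a4 := Worth.short (a := true) (b := false) (v := ε + min (2 * (ε - ρ)) 0) hj hρ0.le b2
    (s1 _ _) le_rfl (by linarith [min_le_right (2 * (ε - ρ)) 0])
  obtain ⟨n, s2⟩ := Worth.single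
    (v := min (2 * (ε + min (2 * (ε - ρ)) 0)) (1 - ρ * j)) hj hρ0.le a4 (min_le_left _ _)
    (min_le_right _ _)
  refine ⟨n, _, lt_min ?_ (by linarith), s2 _ _⟩
  rcases min_cases (2 * (ε - ρ)) 0 with ⟨h, -⟩ | ⟨h, -⟩ <;> rw [h] <;> linarith

end

/-! ### Plans for recourse four -/

section

variable {R : ℕ} {w : ℕ → ℝ} {wt : ℕ → ℕ} {n : ℕ} {s v : ℝ}

/-- The path `1, 2, 3` is extended, and its end `3, 4, 1` is cut off. -/
theorem Worth.four_long (a b : Bool) (hs : Worth 4 (3 / 7) R w wt n false true [1] s)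
    (hv : v ≤ 1 / 7 + s) (hv' : v ≤ 1 / 7) :
    Worth 4 (3 / 7) R w wt (n + 4) a b [1, 2, 3] v := by
  have h : Worth 4 (3 / 7) R w wt (n + 1) true false [1] s := .symm (by simpa using hs) (by omega)
  exact Worth.long (j := 1) odd_one (by norm_num) h (by linarith) (by norm_num; linarith)

/-- The path `1, 2, 1` is extended to `1, 2, 3, 2, 1`, which is cut into `1, 2, 3` and a single
edge. -/
theorem Worth.four_tent (a b : Bool) (hs : Worth 4 (3 / 7) R w wt n false true [1] s)
    (hv : v ≤ 1 / 7 + 2 * s) (hv' : v ≤ 1 / 7) :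
    Worth 4 (3 / 7) R w wt (2 * n + 6) a b [1, 2, 1] v := by
  refine .extend (n := 2 * n + 5) (v' := v) ?_ le_rfl ?_ (by omega)
  · refine .cut (t₁ := [1, 2, 3]) (x := 2) (t₂ := [1]) (v₁ := min (1 / 7 + s) (1 / 7)) ⟨1, rfl⟩
      ⟨0, rfl⟩ (hs.four_long _ _ (min_le_left _ _) (min_le_right _ _)) hs ?_ ?_ (by omega)
    · rcases min_cases (1 / 7 + s) (1 / 7) with ⟨h, -⟩ | ⟨h, -⟩ <;> rw [h] <;> linarith
    · norm_num [size]
      linarith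
  · norm_num [size]
    linarith

/-- The path made from two deposited edges is extended to `1, 2, 3, 2, 3, 2, 1` and cut in the
middle. -/
theorem Worth.four_chain_two (hs : Worth 4 (3 / 7) R w wt n false true [1] s)
    (hv : v ≤ 2 / 7 + 2 * s) (hv' : v ≤ -2 / 7) :
    Worth 4 (3 / 7) R w wt (2 * n + 11) true true (chain 2) v := by
  have hl : ∀ a b, Worth 4 (3 / 7) R w wt (n + 4) a b [1, 2, 3] (v / 2) := fun a b =>
    hs.four_long a b (by linarith) (by linarith)
  refine .extend (t := [1, 2, 1, 2, 1]) (n := 2 * n + 10) (v' := v) ?_ le_rfl ?_ (by omega)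
  · refine .cut (t₁ := [1, 2, 3]) (x := 2) (t₂ := [3, 2, 1]) (v₁ := v / 2) (v₂ := v / 2) ⟨1, rfl⟩
      ⟨1, rfl⟩ (hl _ _) (.symm (n := n + 4) (hl _ _) (Nat.lt_succ_self _)) (by linarith) ?_
      (by omega)
    norm_num [size]
    linarith
  · norm_num [size]
    linarith

/-- The path made from three deposited edges is cut in the middle into two paths `1, 2, 1`. -/
theorem Worth.four_chain_three (hs : Worth 4 (3 / 7) R w wt n false true [1] s)
    (hv : v ≤ 2 / 7 + 4 * s) (hv' : v ≤ -2 / 7) :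
    Worth 4 (3 / 7) R w wt (4 * n + 13) true true (chain 3) v := by
  have ht : ∀ a b, Worth 4 (3 / 7) R w wt (2 * n + 6) a b [1, 2, 1] (v / 2) := fun a b =>
    hs.four_tent a b (by linarith) (by linarith)
  refine .cut (t₁ := [1, 2, 1]) (x := 2) (t₂ := [1, 2, 1]) ⟨1, rfl⟩ ⟨1, rfl⟩ (ht _ _) (ht _ _)
    (by linarith) ?_ (by omega)
  norm_num [size]
  linarith

/-- A single edge is extended to `1, 2, 1`, from which another single edge is won. -/
theorem Worth.four_single (a b : Bool) (hs : Worth 4 (3 / 7) R w wt n false true [1] s)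
    (hv : v ≤ 1 / 7 + 2 * s) (hv' : v ≤ 1 / 7) :
    Worth 4 (3 / 7) R w wt (2 * n + 7) a b [1] v := by
  refine .extend (n := 2 * n + 6) (v' := v) (hs.four_tent _ _ hv hv') le_rfl ?_ (by omega)
  norm_num [size]
  linarith

/-- For `k = 4` single edges are collected in three banks, each of which uses the previous one, if
any, and pays more for an edge. An edge of the last bank is worth `-2 / 21`, and above `-1 / 7` the
plan for single edges improves itself until it is worth a positive amount. -/
theorem not_isCompetitive_four {A : OnlineAlgorithm} {c : ℝ} (hc : c < 1 + 3 / 7)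
    (hA : SolvesWithRecourse 4 A) : ¬ IsCompetitive A c := by
  -- The weights `6`, `12`, `21` only have to exceed those of the plans, divided by the number of
  -- edges that a bank collects: `11 / 2`, `23 / 2`, `61 / 3`.
  let w : ℕ → ℝ := fun r => if r = 0 then -2 / 7 else if r = 1 then -1 / 7 else -2 / 21
  let wt : ℕ → ℕ := fun r => if r = 0 then 6 else if r = 1 then 12 else 21
  have hstay : Worth 4 (3 / 7) 3 w wt 0 false true [1] (-3 / 7) := .stay (by norm_num [size])
  have h0 : Worth 4 (3 / 7) 3 w wt 6 false true [1] (-2 / 7) :=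
    .deposit (r := 0) (by omega) (by simp [w]) (by simp [wt])
  have h1 : Worth 4 (3 / 7) 3 w wt 12 false true [1] (-1 / 7) :=
    .deposit (r := 1) (by omega) (by simp [w]) (by simp [wt])
  have h2 : Worth 4 (3 / 7) 3 w wt 21 false true [1] (-2 / 21) :=
    .deposit (r := 2) (by omega) (by simp [w]) (by simp [wt])
  have h3 := h2.four_single (v := -1 / 21) false true (by norm_num) (by norm_num)
  have h4 := h3.four_single (v := 1 / 21) true true (by norm_num) (by norm_num)
  refine not_isCompetitive (R := 3) (w := w) (wt := wt) (m := fun r => if r = 2 then 3 else 2)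
    hc hA (by norm_num) ?_ ?_ (by norm_num) h4
  · intro r hr
    interval_cases r <;> norm_num [w]
  · intro r hr
    interval_cases r
    · exact ⟨11, by norm_num [wt], hstay.four_chain_two (by norm_num [w]) (by norm_num [w])⟩
    · exact ⟨23, by norm_num [wt], h0.four_chain_two (by norm_num [w]) (by norm_num [w])⟩
    · exact ⟨61, by norm_num [wt], h1.four_chain_three (by norm_num [w]) (by norm_num [w])⟩

end

end RecourseMatching

theorem mainTheorem5 (k : ℕ) (hk : 4 ≤ k) (hkeven : Even k)
    (A : RecourseMatching.OnlineAlgorithm) (hA : RecourseMatching.SolvesWithRecourse k A) :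
    ((((k : ℝ) ^ 2 - 3 * (k : ℝ) + 6) / ((k : ℝ) ^ 2 - 4 * (k : ℝ) + 7) : ℝ) : EReal) ≤
      RecourseMatching.competitiveRatio A := by
  refine le_iInf₂ fun c hc => EReal.coe_le_coe_iff.2 ?_
  by_contra hlt
  rw [not_le] at hlt
  obtain rfl | hk6 : k = 4 ∨ 6 ≤ k := by
    obtain ⟨i, rfl⟩ := hkeven
    omega
  · refine RecourseMatching.not_isCompetitive_four ?_ hA hc
    norm_num at hlt ⊢
    exact hlt
  · obtain ⟨j, rfl⟩ : ∃ j, k = j + 3 := ⟨k - 3, by omega⟩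
    have hj : Odd j := by grind
    push_cast at hlt
    have hD : (0 : ℝ) < ((j : ℝ) + 3) ^ 2 - 4 * ((j : ℝ) + 3) + 7 := by
      nlinarith [sq_nonneg ((j : ℝ) + 1)]
    obtain ⟨n, v, hv, hW⟩ := RecourseMatching.exists_worth_pos
      (ρ := ((j : ℝ) + 2) / (((j : ℝ) + 3) ^ 2 - 4 * ((j : ℝ) + 3) + 7)) (R := 0)
      (w := fun _ => 0) (wt := fun _ => 0) hj (by omega) (div_mul_cancel₀ _ hD.ne')
    refine RecourseMatching.not_isCompetitive (m := fun _ => 0) (hlt.trans_eq ?_) hA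
      (by positivity) (by simp) (by simp) hv hW hc
    rw [one_add_div hD.ne']
    congr 1
    ring
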